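/- Let $N\ge 1$ and let $\gamma_1,\dots,\gamma_N$ be real numbers such that $$\Bigl|\sum_{n=K}^M\gamma_n\Bigr|<1\quad\text{for all }1\le K\le M\le N,\qquad \sum_{n=K}^M\gamma_n\ne 0\quad\text{for all }2\le K\le M\le N.$$ For real $E$, a PT-invariant stationary solution is a vector $\mathbf w=(w_{-N+1},\dots,w_N)\in\mathbb C^{2N}$ with $w_{1-n}=\overline{w_n}$ for all $n$ that satisfies $$E w_n=w_{n+1}+w_{n-1}+i\gamma_n w_n+|w_n|^2w_n,\qquad 1\le n\le N,$$ where $w_0=\overline{w_1}$ and $w_{N+1}=0$. Then there are constants $E_0>0$ and $C>0$ such that for every $E>E_0$ there are exactly $2^{N+1}-2$ nonzero PT-invariant stationary solutions, counted up to the gauge transformation $\mathbf w\mapsto-\mathbf w$. Moreover these solutions form, for $M=1,\dots,N$, $2^M$ families $E\mapsto\mathbf w(E)$ that are $C^\infty$ on $(E_0,\infty)$ and satisfy there $$\bigl||w_n|^2-E\bigr|\le C\quad(1\le n\le M),\qquad |w_n|^2\le CE^{-1}\quad(M+1\le n\le N);$$ for every $E>E_0$ the members of distinct families (over all $M=1,\dots,N$)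 are distinct up to sign, and every nonzero PT-invariant stationary solution is, up to sign, a member of one of these families. -/

import Mathlib

/-!
Stationary modes of the PT-symmetric discrete nonlinear Schroedinger network with `2N` sites
`n = -N+1, ..., N`. A state is a function `w : ℤ → ℂ` that vanishes off these sites.
-/

namespace PTNetwork

/-- The operator `PT`: reflection of the sites `n ↦ 1 - n` followed by complex conjugation. -/
noncomputable def PT (w : ℤ → ℂ) : ℤ → ℂ := fun n => (starRingEnd ℂ) (w (1 - n))

/-- `w` is a PT-invariant stationary mode with energy `E`. At `n = 1` invariance gives the
boundary condition `w 0 = conj (w 1)`; the support condition gives `w (N + 1) = 0`. -/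
structure IsPTMode (N : ℕ) (γ : ℤ → ℝ) (E : ℝ) (w : ℤ → ℂ) : Prop where
  support : ∀ n : ℤ, n < -(N : ℤ) + 1 ∨ (N : ℤ) < n → w n = 0
  invariant : PT w = w
  stationary : ∀ n : ℤ, 1 ≤ n → n ≤ (N : ℤ) →
    (E : ℂ) * w n = w (n + 1) + w (n - 1) + Complex.I * (γ n : ℂ) * w n
      + ((‖w n‖ ^ 2 : ℝ) : ℂ) * w n

/-- The set of nonzero PT-invariant stationary modes with energy `E`. -/
def modes (N : ℕ) (γ : ℤ → ℝ) (E : ℝ) : Set (ℤ → ℂ) :=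
  {w | IsPTMode N γ E w ∧ w ≠ 0}

/-- The gauge class of `w` under the gauge transformation `w ↦ -w`. -/
def gaugeClass (w : ℤ → ℂ) : Set (ℤ → ℂ) := {w, -w}

/-- `u` is a smooth family, over energies `E > E₀`, of nonzero PT-invariant stationary modes whose
large-amplitude sites in `1, ..., N` are exactly `1, ..., M`, with the `E`-independent
constant `C` in the amplitude bounds. -/
structure IsModeFamily (N : ℕ) (γ : ℤ → ℝ) (M : ℕ) (E₀ C : ℝ) (u : ℝ → ℤ → ℂ) : Prop where
  mem_modes : ∀ E : ℝ, E₀ < E → u E ∈ modes N γ E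
  smooth : ∀ n : ℤ, ContDiffOn ℝ (⊤ : ℕ∞) (fun E => u E n) (Set.Ioi E₀)
  large : ∀ E : ℝ, E₀ < E → ∀ n : ℤ, 1 ≤ n → n ≤ (M : ℤ) → |‖u E n‖ ^ 2 - E| ≤ C
  small : ∀ E : ℝ, E₀ < E → ∀ n : ℤ, (M : ℤ) < n → n ≤ (N : ℤ) → ‖u E n‖ ^ 2 ≤ C * E⁻¹

end PTNetwork

namespace PTNetwork

open Filter Topology ContDiff ComplexConjugate

/-! Put `w = √E v` and `ε = 1 / E`. The equations become `v_n (1 - |v_n|²) = ε (v_{n+1} + v_{n-1} +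
i γ_n v_n)`, a perturbation problem at `ε = 0`. The equations alone are degenerate there: each site
is zero or has modulus one, with arbitrary phase. The missing information is in the imaginary part
of the equation times `conj v_n`: a factor `ε` cancels, and summing from `v_{N+1} = 0` shows that
the current through the bond `(n - 1, n)` equals the gain on `n, ..., N`. This law is adjoined to
the system (`Solves`) and kept at `ε = 0`.

At `ε = 0` a block of unit sites preceded and followed by zeros would have total gain zero. The
nonvanishing hypothesis excludes this for blocks starting at a site `≥ 2`, so the unit sites are
exactly `1, ..., M` (`Solves.exists_isLimit`). Each bond `v_n conj v_{n-1}` then has modulus one and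
prescribed imaginary part of absolute value less than one, hence two possible values. The first bond
is `v_1²`, so the `M` bonds determine `v` up to sign, giving `2^M` classes for each `M`.

Near such a limit, the equation at a large site may be replaced by its radial part and the current
law. The resulting map has injective linearization at the limit
(`IsLimit.fderiv_reducedMap_injective`), and the implicit function theorem yields one smooth,
locally unique branch. An a priori bound and compactness (`eventually_solves_mem`) put every
solution for small `ε > 0` near one of the finitely many limits, so the branches are all the
solutions. -/

/-! ### The implicit function theorem for curves of zeros -/

/-- Near a nondegenerate zero `p` of `G (0, ·)` the zeros of `G` form a smooth curve. -/
theorem exists_implicit_curve {X : Type*} [NormedAddCommGroup X] [NormedSpace ℝ X]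
    [FiniteDimensional ℝ X] {G : ℝ × X → X} (hG : ContDiff ℝ ω G) {p : X} (hp : G (0, p) = 0)
    (hinj : ∀ h, fderiv ℝ G (0, p) (0, h) = 0 → h = 0) :
    ∃ φ : ℝ → X, ∃ C : ℝ, φ 0 = p ∧ (∀ᶠ ε in 𝓝 0, ContDiffAt ℝ ω φ ε) ∧
      (∀ᶠ ε in 𝓝 0, G (ε, φ ε) = 0) ∧ (∀ᶠ v in 𝓝 ((0 : ℝ), p), G v = 0 → φ v.1 = v.2) ∧
      ∀ᶠ ε in 𝓝 (0 : ℝ), ‖φ ε - p‖ ≤ C * |ε| := by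
  have := FiniteDimensional.complete ℝ X
  have hinv : (fderiv ℝ G (0, p) ∘L .inr ℝ ℝ X).IsInvertible := by
    -- Finite dimension turns the assumed injectivity of the partial derivative into invertibility.
    have hinj' : Function.Injective (fderiv ℝ G (0, p) ∘L .inr ℝ ℝ X : X →L[ℝ] X).toLinearMap :=
      (injective_iff_map_eq_zero _).2 fun h hh => hinj h (by simpa using hh)
    refine ⟨(LinearEquiv.ofInjectiveEndo _ hinj').toContinuousLinearEquiv, ?_⟩
    ext h
    simp
  have hn : (ω : ℕ∞ω) ≠ 0 := by simp
  have hG' := hG.contDiffAt (x := ((0 : ℝ), p))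
  have h0 := hG'.implicitFunction_apply_self hn hinv
  have hs := hG'.contDiffAt_implicitFunction hn hinv
  have hd := (hs.differentiableAt hn).hasFDerivAt.isBigO_sub
  obtain ⟨C, hC⟩ := hd.bound
  refine ⟨hG'.implicitFunction hn hinv, C, h0, hs.eventually (by simp), ?_, ?_, ?_⟩
  · simpa [hp] using hG'.eventually_apply_implicitFunction hn hinv
  · filter_upwards [hG'.eventually_apply_eq_iff_implicitFunction hn hinv] with v hv h
    exact hv.1 (h.trans hp.symm)
  · filter_upwards [hC] with ε hε
    simpa [h0] using hε

/-! ### Configurations of the half network -/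

/-- The values of a mode on the sites `1, ..., N`, which determine it. -/
abbrev Config (N : ℕ) := Finset.Icc (1 : ℤ) N → ℂ

/-- The value at site `n` of the `PT`-invariant state with prescribed values on `1, ..., N`. -/
noncomputable def site {N : ℕ} (n : ℤ) : Config N →L[ℝ] ℂ :=
  if h : n ∈ Finset.Icc (1 : ℤ) N then ContinuousLinearMap.proj (⟨n, h⟩ : Finset.Icc (1 : ℤ) N)
  else if h : 1 - n ∈ Finset.Icc (1 : ℤ) N then
    (Complex.conjCLE : ℂ →L[ℝ] ℂ) ∘L
      ContinuousLinearMap.proj (⟨1 - n, h⟩ : Finset.Icc (1 : ℤ) N)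
  else 0

variable {N : ℕ}

theorem site_coe (v : Config N) (i : Finset.Icc (1 : ℤ) N) : site (i : ℤ) v = v i := by
  simp [site, i.2]

theorem site_of_mem (v : Config N) {n : ℤ} (h : n ∈ Finset.Icc (1 : ℤ) N) :
    site n v = v ⟨n, h⟩ := site_coe v ⟨n, h⟩

theorem site_eq_zero (v : Config N) {n : ℤ} (h : n < -(N : ℤ) + 1 ∨ (N : ℤ) < n) :
    site n v = 0 := by
  have h1 : n ∉ Finset.Icc (1 : ℤ) N := by rw [Finset.mem_Icc]; omega
  have h2 : 1 - n ∉ Finset.Icc (1 : ℤ) N := by rw [Finset.mem_Icc]; omega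
  simp only [site, h1, h2, dif_neg, not_false_eq_true, zero_apply]

theorem site_reflect (v : Config N) (n : ℤ) : site (1 - n) v = conj (site n v) := by
  by_cases h1 : n ∈ Finset.Icc (1 : ℤ) N
  · have h2 : 1 - n ∉ Finset.Icc (1 : ℤ) N := by rw [Finset.mem_Icc] at *; omega
    have h3 : 1 - (1 - n) ∈ Finset.Icc (1 : ℤ) N := by simpa using h1
    simp only [site, h1, h2, h3, dif_neg, dif_pos, not_false_eq_true]
    simp
  · by_cases h2 : 1 - n ∈ Finset.Icc (1 : ℤ) N
    · simp only [site, h1, h2, dif_neg, dif_pos, not_false_eq_true]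
      simp
    · have h3 : 1 - (1 - n) ∉ Finset.Icc (1 : ℤ) N := by simpa using h1
      simp only [site, h1, h2, h3, dif_neg, not_false_eq_true]
      simp

theorem site_zero (v : Config N) : site 0 v = conj (site 1 v) := by
  simpa using site_reflect v 1

theorem config_ext {v v' : Config N} (h : ∀ n : ℤ, 1 ≤ n → n ≤ N → site n v = site n v') :
    v = v' := by
  ext i
  have hi := Finset.mem_Icc.1 i.2
  rw [← site_coe v i, ← site_coe v' i, h _ hi.1 hi.2]

theorem norm_site_le (v : Config N) (n : ℤ) : ‖site n v‖ ≤ ‖v‖ := by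
  by_cases h1 : n ∈ Finset.Icc (1 : ℤ) N
  · rw [site_of_mem v h1]
    exact norm_le_pi_norm v _
  · by_cases h2 : 1 - n ∈ Finset.Icc (1 : ℤ) N
    · rw [← Complex.norm_conj, ← site_reflect, site_of_mem v h2]
      exact norm_le_pi_norm v _
    · rw [Finset.mem_Icc] at h1 h2
      rw [site_eq_zero v (by omega), norm_zero]
      exact norm_nonneg v

/-! ### The rescaled equations -/

/-- The stationary equation at site `n` in terms of `v = w / √E` and `ε = 1 / E`. -/
def BalancedAt (γ : ℤ → ℝ) (ε : ℝ) (w : ℤ → ℂ) (n : ℤ) : Prop :=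
  w n * (1 - (Complex.normSq (w n) : ℂ))
    = ε * (w (n + 1) + w (n - 1) + Complex.I * (γ n : ℂ) * w n)

/-- The current between the sites `n - 1` and `n`. -/
noncomputable def flux (w : ℤ → ℂ) (n : ℤ) : ℝ := (w n * conj (w (n - 1))).im

/-- The total gain on the sites `n, ..., N`. -/
noncomputable def tailGain (N : ℕ) (γ : ℤ → ℝ) (w : ℤ → ℂ) (n : ℤ) : ℝ :=
  ∑ k ∈ Finset.Icc n (N : ℤ), γ k * Complex.normSq (w k)

/-- The real part of the stationary equation multiplied by `conj (w n)`. -/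
noncomputable def radialDefect (ε : ℝ) (w : ℤ → ℂ) (n : ℤ) : ℝ :=
  (1 - Complex.normSq (w n)) * Complex.normSq (w n)
    - ε * ((w (n + 1) + w (n - 1)) * conj (w n)).re

theorem BalancedAt.radialDefect_eq_zero {γ : ℤ → ℝ} {ε : ℝ} {w : ℤ → ℂ} {n : ℤ}
    (h : BalancedAt γ ε w n) : radialDefect ε w n = 0 := by
  have h1 := congrArg (fun z => (z * conj (w n)).re) h
  simp only [Complex.normSq_apply, Complex.mul_re, Complex.mul_im, Complex.sub_re, Complex.sub_im,
    Complex.add_re, Complex.add_im, Complex.ofReal_re, Complex.ofReal_im, Complex.I_re,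
    Complex.I_im, Complex.conj_re, Complex.conj_im, Complex.one_re, Complex.one_im] at h1
  simp only [radialDefect, Complex.normSq_apply, Complex.mul_re, Complex.add_re, Complex.add_im,
    Complex.conj_re, Complex.conj_im]
  linear_combination h1

/-- In the imaginary part after multiplication by `conj (w n)` the nonlinear term drops out and
every remaining term carries a factor `ε`, which cancels. -/
theorem BalancedAt.flux_eq {γ : ℤ → ℝ} {ε : ℝ} {w : ℤ → ℂ} {n : ℤ} (hε : ε ≠ 0)
    (h : BalancedAt γ ε w n) : flux w n = flux w (n + 1) + γ n * Complex.normSq (w n) := by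
  have h1 := congrArg (fun z => (z * conj (w n)).im) h
  apply mul_left_cancel₀ hε
  simp only [Complex.normSq_apply, Complex.mul_re, Complex.mul_im, Complex.sub_re, Complex.sub_im,
    Complex.add_re, Complex.add_im, Complex.ofReal_re, Complex.ofReal_im, Complex.I_re,
    Complex.I_im, Complex.conj_re, Complex.conj_im, Complex.one_re, Complex.one_im] at h1
  simp only [flux, Complex.normSq_apply, Complex.mul_im, add_sub_cancel_right,
    Complex.conj_re, Complex.conj_im]
  linear_combination h1

/-- The two hypotheses give the real and imaginary parts of the equation times `conj (w n)`; this
factor can be cancelled only at a nonzero site. -/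
theorem balancedAt_of_radialDefect_of_flux {γ : ℤ → ℝ} {ε : ℝ} {w : ℤ → ℂ} {n : ℤ}
    (hw : w n ≠ 0) (hr : radialDefect ε w n = 0)
    (hf : flux w n = flux w (n + 1) + γ n * Complex.normSq (w n)) : BalancedAt γ ε w n := by
  have hc : conj (w n) ≠ 0 := by simpa using hw
  apply mul_right_cancel₀ hc
  simp only [radialDefect, Complex.normSq_apply, Complex.mul_re, Complex.add_re, Complex.add_im,
    Complex.conj_re, Complex.conj_im] at hr
  simp only [flux, Complex.normSq_apply, Complex.mul_im, add_sub_cancel_right,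
    Complex.conj_re, Complex.conj_im] at hf
  apply Complex.ext <;>
  simp only [Complex.normSq_apply, Complex.mul_re, Complex.mul_im, Complex.sub_re, Complex.sub_im,
    Complex.add_re, Complex.add_im, Complex.ofReal_re, Complex.ofReal_im, Complex.I_re,
    Complex.I_im, Complex.conj_re, Complex.conj_im, Complex.one_re, Complex.one_im]
  · linear_combination hr
  · linear_combination ε * hf

theorem tailGain_eq_add (γ : ℤ → ℝ) (w : ℤ → ℂ) {n : ℤ} (hn : n ≤ N) :
    tailGain N γ w n = tailGain N γ w (n + 1) + γ n * Complex.normSq (w n) := by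
  rw [tailGain, ← Finset.insert_Icc_add_one_left_eq_Icc hn,
    Finset.sum_insert (by simp), add_comm, tailGain]

theorem tailGain_of_lt (γ : ℤ → ℝ) (w : ℤ → ℂ) {n : ℤ} (hn : (N : ℤ) < n) :
    tailGain N γ w n = 0 := by
  rw [tailGain, Finset.Icc_eq_empty (by omega), Finset.sum_empty]

/-- If the sites beyond `M` are balanced then the current law holds there. -/
theorem flux_eq_tailGain_of_balancedAt {γ : ℤ → ℝ} {ε : ℝ} (hε : ε ≠ 0) {w : ℤ → ℂ} {M : ℤ}
    (hN : w (N + 1) = 0) (h : ∀ n, M < n → n ≤ N → BalancedAt γ ε w n) :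
    ∀ n, M < n → n ≤ N + 1 → flux w n = tailGain N γ w n := by
  suffices H : ∀ n ≤ (N : ℤ) + 1, M < n → flux w n = tailGain N γ w n from
    fun n h1 h2 => H n h2 h1
  refine Int.leInductionDown ?_ ?_
  · intro _
    rw [tailGain_of_lt γ w (by omega), flux, hN]
    simp
  · intro n hn ih hMn
    have := (h (n - 1) hMn (by omega)).flux_eq hε
    rw [sub_add_cancel, ih (by omega)] at this
    rw [this, tailGain_eq_add γ w (n := n - 1) (by omega), sub_add_cancel]

/-- The rescaled stationary equations together with the current law that they imply for
`ε ≠ 0`. Unlike the equations alone, these have finitely many solutions for `ε = 0`. -/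
def Solves (N : ℕ) (γ : ℤ → ℝ) (ε : ℝ) (v : Config N) : Prop :=
  ∀ n : ℤ, 1 ≤ n → n ≤ N →
    BalancedAt γ ε (site · v) n ∧ flux (site · v) n = tailGain N γ (site · v) n

theorem solves_iff_balancedAt {γ : ℤ → ℝ} {ε : ℝ} (hε : ε ≠ 0) {v : Config N} :
    Solves N γ ε v ↔ ∀ n : ℤ, 1 ≤ n → n ≤ N → BalancedAt γ ε (site · v) n := by
  refine ⟨fun h n h1 h2 => (h n h1 h2).1, fun h n h1 h2 => ⟨h n h1 h2, ?_⟩⟩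
  exact flux_eq_tailGain_of_balancedAt hε (M := 0) (site_eq_zero v (by omega))
    (fun n h1 h2 => h n (by omega) h2) n (by omega) (by omega)

/-- The system equivalent to `Solves` near states whose large sites are `1, ..., M`,
in a form that is nondegenerate at `ε = 0`. -/
noncomputable def reducedMap (N : ℕ) (γ : ℤ → ℝ) (M : ℤ) (x : ℝ × Config N) : Config N := fun i =>
  if (i : ℤ) ≤ M then
    (radialDefect x.1 (site · x.2) i : ℂ)
      + ((flux (site · x.2) i - tailGain N γ (site · x.2) i : ℝ) : ℂ) * Complex.I
  else
    site (i : ℤ) x.2 * (1 - (Complex.normSq (site (i : ℤ) x.2) : ℂ))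
      - x.1 * (site (i + 1 : ℤ) x.2 + site (i - 1 : ℤ) x.2
        + Complex.I * (γ i : ℂ) * site (i : ℤ) x.2)

theorem reducedMap_eq_zero_iff {γ : ℤ → ℝ} {M : ℤ} {ε : ℝ} {v : Config N} :
    reducedMap N γ M (ε, v) = 0 ↔ ∀ n : ℤ, 1 ≤ n → n ≤ N →
      (n ≤ M → radialDefect ε (site · v) n = 0 ∧
        flux (site · v) n = tailGain N γ (site · v) n) ∧
      (M < n → BalancedAt γ ε (site · v) n) := by
  have key : ∀ a b : ℝ, (a : ℂ) + (b : ℂ) * Complex.I = 0 ↔ a = 0 ∧ b = 0 := fun a b => by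
    simp [Complex.ext_iff]
  rw [funext_iff]
  constructor
  · intro h n h1 h2
    have hn := h ⟨n, Finset.mem_Icc.2 ⟨h1, h2⟩⟩
    refine ⟨fun hM => ?_, fun hM => ?_⟩
    · simp only [reducedMap, hM, if_true, Pi.zero_apply] at hn
      rw [key, sub_eq_zero] at hn
      exact hn
    · simp only [reducedMap, not_le.2 hM, if_false, Pi.zero_apply] at hn
      exact sub_eq_zero.1 hn
  · rintro h ⟨n, hn⟩
    rw [Finset.mem_Icc] at hn
    obtain ⟨ha, hb⟩ := h n hn.1 hn.2
    by_cases hM : n ≤ M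
    · simp only [reducedMap, hM, if_true, Pi.zero_apply]
      rw [key, sub_eq_zero]
      exact ha hM
    · simp only [reducedMap, hM, if_false, Pi.zero_apply]
      exact sub_eq_zero.2 (hb (not_le.1 hM))

theorem Solves.reducedMap_eq_zero {γ : ℤ → ℝ} {ε : ℝ} {v : Config N} (h : Solves N γ ε v)
    (M : ℤ) : reducedMap N γ M (ε, v) = 0 :=
  reducedMap_eq_zero_iff.2 fun n h1 h2 =>
    ⟨fun _ => ⟨(h n h1 h2).1.radialDefect_eq_zero, (h n h1 h2).2⟩, fun _ => (h n h1 h2).1⟩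

/-- The sites beyond `M` are balanced outright, which gives the current law there, in particular at
`M + 1`. Differences of consecutive current laws then recover the imaginary part of the equation at
each large site. -/
theorem solves_of_reducedMap_eq_zero {γ : ℤ → ℝ} {M : ℤ} {ε : ℝ} {v : Config N} (hε : ε ≠ 0)
    (hM : M ≤ N) (hv : ∀ n : ℤ, 1 ≤ n → n ≤ M → site n v ≠ 0)
    (h : reducedMap N γ M (ε, v) = 0) : Solves N γ ε v := by
  rw [reducedMap_eq_zero_iff] at h
  rw [solves_iff_balancedAt hε]
  intro n h1 h2
  rcases lt_or_ge M n with hn | hn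
  · exact (h n h1 h2).2 hn
  have hflux : flux (site · v) (n + 1) = tailGain N γ (site · v) (n + 1) := by
    rcases lt_or_ge M (n + 1) with hn' | hn'
    · refine flux_eq_tailGain_of_balancedAt hε (site_eq_zero v (by omega))
        (fun k hk1 hk2 => (h k (by omega) hk2).2 hk1) _ hn' (by omega)
    · exact ((h (n + 1) (by omega) (by omega)).1 hn').2
  obtain ⟨hr, hf⟩ := (h n h1 h2).1 hn
  refine balancedAt_of_radialDefect_of_flux (hv n h1 hn) hr ?_
  rw [hf, hflux, tailGain_eq_add γ _ h2]

theorem contDiff_reducedMap (γ : ℤ → ℝ) (M : ℤ) : ContDiff ℝ ω (reducedMap N γ M) := by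
  have hs : ∀ n : ℤ, ContDiff ℝ ω (fun x : ℝ × Config N => site n x.2) := fun n =>
    (site n).contDiff.comp contDiff_snd
  have hre : ContDiff ℝ ω Complex.re := Complex.reCLM.contDiff
  have him : ContDiff ℝ ω Complex.im := Complex.imCLM.contDiff
  have hof : ContDiff ℝ ω ((↑) : ℝ → ℂ) := Complex.ofRealCLM.contDiff
  have hcj : ContDiff ℝ ω (fun z : ℂ => conj z) := Complex.conjCLE.contDiff
  have hnq : ContDiff ℝ ω (fun z : ℂ => Complex.normSq z) := by
    simp only [Complex.normSq_apply]
    exact (hre.mul hre).add (him.mul him)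
  have hN : ∀ n : ℤ, ContDiff ℝ ω (fun x : ℝ × Config N => Complex.normSq (site n x.2)) :=
    fun n => hnq.comp (hs n)
  refine contDiff_pi.2 fun i => ?_
  unfold reducedMap
  split_ifs
  · refine (hof.comp ?_).add ((hof.comp ?_).mul contDiff_const)
    · exact ((contDiff_const.sub (hN _)).mul (hN _)).sub
        (contDiff_fst.mul (hre.comp (((hs _).add (hs _)).mul (hcj.comp (hs _)))))
    · exact (him.comp ((hs _).mul (hcj.comp (hs _)))).sub
        (ContDiff.sum fun k _ => contDiff_const.mul (hN k))
  · exact ((hs _).mul (contDiff_const.sub (hof.comp (hN _)))).sub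
      ((hof.comp contDiff_fst).mul (((hs _).add (hs _)).add (contDiff_const.mul (hs _))))

/-! ### The solutions at `ε = 0` -/

theorem tailGain_eq_sum_add (γ : ℤ → ℝ) (w : ℤ → ℂ) {a b : ℤ} (hab : a ≤ b + 1) (hb : b ≤ N) :
    tailGain N γ w a
      = ∑ k ∈ Finset.Icc a b, γ k * Complex.normSq (w k) + tailGain N γ w (b + 1) := by
  have : Finset.Icc a (N : ℤ) = Finset.Icc a b ∪ Finset.Icc (b + 1) (N : ℤ) := by
    ext k
    simp only [Finset.mem_union, Finset.mem_Icc]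
    omega
  rw [tailGain, this, Finset.sum_union, tailGain]
  rw [Finset.disjoint_left]
  intro k
  simp only [Finset.mem_Icc]
  omega

/-- `p` has modulus one on the sites `1, ..., M`, vanishes on `M + 1, ..., N`, and obeys the
current law. -/
structure IsLimit (γ : ℤ → ℝ) (M : ℤ) (p : Config N) : Prop where
  large : ∀ n : ℤ, 1 ≤ n → n ≤ M → Complex.normSq (site n p) = 1
  small : ∀ n : ℤ, M < n → site n p = 0
  flux_eq : ∀ n : ℤ, 1 ≤ n → n ≤ M → flux (site · p) n = ∑ k ∈ Finset.Icc n M, γ k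

theorem tailGain_of_large_of_small {γ : ℤ → ℝ} {M : ℤ} {w : ℤ → ℂ} (hM : M ≤ N)
    (hl : ∀ n : ℤ, 1 ≤ n → n ≤ M → Complex.normSq (w n) = 1) (hs : ∀ n : ℤ, M < n → w n = 0)
    {n : ℤ} (h1 : 1 ≤ n) (h2 : n ≤ M + 1) :
    tailGain N γ w n = ∑ k ∈ Finset.Icc n M, γ k := by
  rw [tailGain_eq_sum_add γ w h2 hM, tailGain, Finset.sum_eq_zero (s := Finset.Icc (M + 1) _),
    add_zero]
  · refine Finset.sum_congr rfl fun k hk => ?_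
    rw [Finset.mem_Icc] at hk
    rw [hl k (by omega) hk.2, mul_one]
  · intro k hk
    rw [Finset.mem_Icc] at hk
    rw [hs k (by omega), map_zero, mul_zero]

theorem IsLimit.solves {γ : ℤ → ℝ} {M : ℤ} {p : Config N} (hM : M ≤ N) (h : IsLimit γ M p) :
    Solves N γ 0 p := by
  intro n h1 h2
  rcases le_or_gt n M with hn | hn
  · refine ⟨?_, ?_⟩
    · simp [BalancedAt, h.large n h1 hn]
    · rw [h.flux_eq n h1 hn, tailGain_of_large_of_small hM h.large h.small h1 (by omega)]
  · refine ⟨?_, ?_⟩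
    · simp [BalancedAt, h.small n hn]
    · rw [flux, h.small n hn, tailGain, Finset.sum_eq_zero]
      · simp
      · intro k hk
        rw [Finset.mem_Icc] at hk
        simp [h.small k (by omega)]

theorem Solves.normSq_eq_one {γ : ℤ → ℝ} {p : Config N} (h : Solves N γ 0 p) {n : ℤ}
    (h1 : 1 ≤ n) (h2 : n ≤ N) (hn : site n p ≠ 0) : Complex.normSq (site n p) = 1 := by
  have := (h n h1 h2).1
  simp only [BalancedAt, Complex.ofReal_zero, zero_mul, mul_eq_zero, hn, false_or] at this
  rw [sub_eq_zero] at this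
  exact_mod_cast this.symm

/-- There are no gaps between the large sites of a solution at `ε = 0`. -/
theorem Solves.site_succ_eq_zero {γ : ℤ → ℝ}
    (hγ : ∀ M K : ℤ, 2 ≤ K → K ≤ M → M ≤ (N : ℤ) → ∑ n ∈ Finset.Icc K M, γ n ≠ 0)
    {p : Config N} (h : Solves N γ 0 p) {n : ℤ} (h1 : 1 ≤ n) (hn : site n p = 0) :
    site (n + 1) p = 0 := by
  by_contra hne
  have hnN : n + 1 ≤ N := by
    by_contra hlt
    exact hne (site_eq_zero p (by omega))
  -- The block of nonzero sites that starts at `n + 1` ends before the first later zero `n + 1 + m`;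
  -- one exists because states vanish beyond `N`.
  have hex : ∃ m : ℕ, site (n + 1 + m) p = 0 :=
    ⟨N, site_eq_zero p (by omega)⟩
  classical
  set m := Nat.find hex with hm
  have hm0 : site (n + 1 + m) p = 0 := Nat.find_spec hex
  have hlt : ∀ k : ℕ, k < m → site (n + 1 + k) p ≠ 0 := fun k hk => Nat.find_min hex hk
  have hmpos : m ≠ 0 := by
    intro h0
    rw [h0] at hm0
    simp [hne] at hm0
  have hmN : n + m ≤ N := by
    by_contra hgt
    refine hlt (m - 1) (by omega) (site_eq_zero p ?_)
    omega
  have hblock : ∀ k ∈ Finset.Icc (n + 1) (n + m), Complex.normSq (site k p) = 1 := by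
    intro k hk
    rw [Finset.mem_Icc] at hk
    refine h.normSq_eq_one (by omega) (by omega) ?_
    have := hlt (k - (n + 1)).toNat (by omega)
    rwa [Int.toNat_of_nonneg (by omega), add_sub_cancel] at this
  -- No current flows through a bond with a vanishing end, so the tail gains at both ends of the
  -- block are zero and the `γ` sum over the block vanishes. The block starts at `n + 1 ≥ 2`, as
  -- `hγ` requires.
  have ht1 : tailGain N γ (site · p) (n + 1) = 0 := by
    rw [← (h (n + 1) (by omega) hnN).2, flux]
    simp [hn]
  have ht2 : tailGain N γ (site · p) (n + m + 1) = 0 := by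
    rcases le_or_gt (n + m + 1) (N : ℤ) with hle | hgt
    · rw [← (h (n + m + 1) (by omega) hle).2, flux]
      rw [show n + 1 + (m : ℤ) = n + m + 1 by ring] at hm0
      simp [hm0]
    · exact tailGain_of_lt _ _ hgt
  have hsum := tailGain_eq_sum_add γ (site · p) (a := n + 1) (b := n + m) (by omega) hmN
  rw [ht1, ht2, add_zero, Finset.sum_congr rfl fun k hk => by rw [hblock k hk, mul_one]] at hsum
  exact hγ (n + m) (n + 1) (by omega) (by omega) hmN hsum.symm

theorem Solves.exists_isLimit {γ : ℤ → ℝ}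
    (hγ : ∀ M K : ℤ, 2 ≤ K → K ≤ M → M ≤ (N : ℤ) → ∑ n ∈ Finset.Icc K M, γ n ≠ 0)
    {p : Config N} (h : Solves N γ 0 p) : ∃ M : ℕ, M ≤ N ∧ IsLimit γ M p := by
  have hex : ∃ m : ℕ, site ((m : ℤ) + 1) p = 0 := ⟨N, site_eq_zero p (by omega)⟩
  classical
  obtain ⟨M, hM0, hlt⟩ : ∃ M : ℕ, site ((M : ℤ) + 1) p = 0 ∧
      ∀ m : ℕ, m < M → site ((m : ℤ) + 1) p ≠ 0 :=
    ⟨Nat.find hex, Nat.find_spec hex, fun m hm => Nat.find_min hex hm⟩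
  have hMN : M ≤ N := by
    by_contra hgt
    exact hlt N (by omega) (site_eq_zero p (by omega))
  have hsmall : ∀ n : ℤ, (M : ℤ) < n → site n p = 0 := by
    intro n hn
    refine Int.leInduction (m := (M : ℤ) + 1) (motive := fun n _ => site n p = 0) hM0
      (fun k hk ih => h.site_succ_eq_zero hγ (by omega) ih) n hn
  have hlarge : ∀ n : ℤ, 1 ≤ n → n ≤ M → Complex.normSq (site n p) = 1 := by
    intro n h1 h2
    refine h.normSq_eq_one h1 (by omega) ?_
    have := hlt (n - 1).toNat (by omega)
    rwa [Int.toNat_of_nonneg (by omega), sub_add_cancel] at this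
  refine ⟨M, hMN, hlarge, hsmall, fun n h1 h2 => ?_⟩
  rw [(h n h1 (by omega)).2,
    tailGain_of_large_of_small (by omega) hlarge hsmall h1 (by omega)]

/-! ### Nondegeneracy of the limits -/

theorem IsLimit.normSq_bond {γ : ℤ → ℝ} {M : ℤ} {p : Config N} (h : IsLimit γ M p) {n : ℤ}
    (h1 : 1 ≤ n) (h2 : n ≤ M) : Complex.normSq (site n p * conj (site (n - 1) p)) = 1 := by
  rw [map_mul, Complex.normSq_conj, h.large n h1 h2, one_mul]
  rcases eq_or_lt_of_le h1 with rfl | hn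
  · rw [sub_self, site_zero, Complex.normSq_conj, h.large 1 h1 h2]
  · exact h.large _ (by omega) (by omega)

/-- A bond has modulus one, and its imaginary part is a `γ` sum of absolute value strictly below
one. This strictness is what makes the limits nondegenerate. -/
theorem IsLimit.re_bond_ne_zero {γ : ℤ → ℝ} {M : ℤ} {p : Config N} (h : IsLimit γ M p)
    (hγ : ∀ n : ℤ, 1 ≤ n → n ≤ M → |∑ k ∈ Finset.Icc n M, γ k| < 1) {n : ℤ}
    (h1 : 1 ≤ n) (h2 : n ≤ M) : (site n p * conj (site (n - 1) p)).re ≠ 0 := by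
  intro h0
  have hf : (site n p * conj (site (n - 1) p)).im = _ := h.flux_eq n h1 h2
  have hb := h.normSq_bond h1 h2
  rw [Complex.normSq_apply, h0, hf] at hb
  have := (sq_lt_one_iff_abs_lt_one _).2 (hγ n h1 h2)
  linarith

/-- The first condition makes `z` tangential, `z = i τ u` with `τ` real; the second then reads `τ Re
(u conj q) = 0`. -/
theorem eq_zero_of_re_of_im {z u q : ℂ} (hu : Complex.normSq u = 1) (h1 : (z * conj u).re = 0)
    (h2 : (z * conj q).im = 0) (h3 : (u * conj q).re ≠ 0) : z = 0 := by
  have hz : z = ((z * conj u).im : ℂ) * Complex.I * u := by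
    have hzu : z * conj u = ((z * conj u).im : ℂ) * Complex.I := by
      apply Complex.ext <;> simp [h1]
    have hcu : conj u * u = 1 := by
      rw [mul_comm, Complex.mul_conj, hu, Complex.ofReal_one]
    rw [← hzu, mul_assoc, hcu, mul_one]
  set τ : ℝ := (z * conj u).im
  have h4 : (z * conj q).im = τ * (u * conj q).re := by
    rw [hz, mul_assoc, mul_assoc]
    simp
  rw [h2] at h4
  have hτ : τ = 0 := by
    rcases mul_eq_zero.1 h4.symm with h | h
    · exact h
    · exact absurd h h3
  rw [hz, hτ]
  simp

/-- Squared moduli and currents are quadratic polynomials along a line, so their derivatives at `0`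
are linear coefficients. -/
theorem hasDerivAt_quadratic (a b c : ℝ) :
    HasDerivAt (fun t : ℝ => a + b * t + c * t ^ 2) b 0 := by
  have h := (((hasDerivAt_id' (0 : ℝ)).const_mul b).const_add a).fun_add
    (((hasDerivAt_id' (0 : ℝ)).fun_pow 2).const_mul c)
  simpa using h

theorem normSq_add_smul (a b : ℂ) (t : ℝ) : Complex.normSq (a + t • b)
    = Complex.normSq a + 2 * (b * conj a).re * t + Complex.normSq b * t ^ 2 := by
  simp only [Complex.normSq_apply, Complex.add_re, Complex.add_im, Complex.smul_re,
    Complex.smul_im, Complex.mul_re, Complex.conj_re, Complex.conj_im, smul_eq_mul]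
  ring

theorem hasDerivAt_normSq_line (a b : ℂ) :
    HasDerivAt (fun t : ℝ => Complex.normSq (a + t • b)) (2 * (b * conj a).re) 0 := by
  have h := hasDerivAt_quadratic (Complex.normSq a) (2 * (b * conj a).re) (Complex.normSq b)
  simpa only [normSq_add_smul] using h

theorem hasDerivAt_im_mul_conj_line (a b c d : ℂ) :
    HasDerivAt (fun t : ℝ => ((a + t • b) * conj (c + t • d)).im)
      (b * conj c + a * conj d).im 0 := by
  have h := hasDerivAt_quadratic (a * conj c).im (b * conj c + a * conj d).im (b * conj d).im
  convert h using 2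
  simp only [Complex.add_re, Complex.add_im, Complex.smul_re, map_add,
    Complex.smul_im, Complex.mul_im, Complex.conj_re, Complex.conj_im, smul_eq_mul]
  ring

/-- The linearization is triangular: radial variations and those at small sites vanish at once, and
the current law then kills the phase variations successively from site `1` to `M`. -/
theorem IsLimit.fderiv_reducedMap_injective {γ : ℤ → ℝ} {M : ℤ} {p : Config N}
    (hp : IsLimit γ M p) (hM : M ≤ N)
    (hγ : ∀ n : ℤ, 1 ≤ n → n ≤ M → |∑ k ∈ Finset.Icc n M, γ k| < 1) (h : Config N)
    (hh : fderiv ℝ (reducedMap N γ M) (0, p) (0, h) = 0) : h = 0 := by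
  have hline : HasDerivAt (fun t : ℝ => reducedMap N γ M (0, p + t • h)) 0 0 := by
    have h1 : HasDerivAt (fun t : ℝ => ((0 : ℝ), p + t • h)) (0, h) 0 := by
      simpa using (hasDerivAt_const (0 : ℝ) (0 : ℝ)).prodMk
        (((hasDerivAt_id (0 : ℝ)).smul_const h).const_add p)
    have h2 : HasFDerivAt (reducedMap N γ M) (fderiv ℝ (reducedMap N γ M) (0, p))
        ((0 : ℝ), p + (0 : ℝ) • h) := by
      rw [zero_smul, add_zero]
      exact ((contDiff_reducedMap γ M).differentiable (by simp) _).hasFDerivAt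
    have h3 := h2.comp_hasDerivAt (0 : ℝ) h1
    rwa [hh] at h3
  have hcoord : ∀ n : ℤ, ∀ h1 : 1 ≤ n, ∀ h2 : n ≤ N, HasDerivAt (fun t : ℝ =>
      reducedMap N γ M (0, p + t • h) ⟨n, Finset.mem_Icc.2 ⟨h1, h2⟩⟩) 0 0 := fun n h1 h2 =>
    hasDerivAt_pi.1 hline ⟨n, Finset.mem_Icc.2 ⟨h1, h2⟩⟩
  have hsite : ∀ (n : ℤ) (t : ℝ), site n (p + t • h) = site n p + t • site n h := by
    intro n t
    rw [map_add, map_smul]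
  have hlarge : ∀ n : ℤ, 1 ≤ n → n ≤ M →
      HasDerivAt (fun t : ℝ => (1 - Complex.normSq (site n p + t • site n h))
        * Complex.normSq (site n p + t • site n h)) 0 0 ∧
      HasDerivAt (fun t : ℝ => flux (fun k => site k p + t • site k h) n
        - tailGain N γ (fun k => site k p + t • site k h) n) 0 0 := by
    intro n h1 h2
    have hc := hcoord n h1 (h2.trans hM)
    simp only [reducedMap, h2, if_true, hsite] at hc
    have hre := Complex.reCLM.hasFDerivAt.comp_hasDerivAt (0 : ℝ) hc
    have him := Complex.imCLM.hasFDerivAt.comp_hasDerivAt (0 : ℝ) hc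
    simp only [Function.comp_def, Complex.reCLM_apply, Complex.imCLM_apply, Complex.add_re,
      Complex.add_im, Complex.ofReal_re, Complex.ofReal_im, Complex.mul_re, Complex.mul_im,
      Complex.I_re, Complex.I_im, radialDefect, map_zero, mul_zero, mul_one, sub_zero, zero_mul,
      add_zero, zero_add] at hre him
    exact ⟨hre, him⟩
  -- The derivative of `s ↦ (1 - s) s` at `s = 1` is `-1`, so the squared modulus has zero
  -- variation.
  have hrad : ∀ n : ℤ, 1 ≤ n → n ≤ M → (site n h * conj (site n p)).re = 0 := by
    intro n h1 h2
    have hd := hasDerivAt_normSq_line (site n p) (site n h)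
    have := (hlarge n h1 h2).1.unique ((hd.const_sub 1).mul hd)
    rw [zero_smul, add_zero, hp.large n h1 h2] at this
    linarith
  have hsm : ∀ n : ℤ, M < n → n ≤ N → 1 ≤ n → site n h = 0 := by
    intro n hn h2 h1
    have hc := hcoord n h1 h2
    simp only [reducedMap, not_le.2 hn, if_false, hsite, hp.small n hn, zero_add,
      Complex.ofReal_zero, zero_mul, sub_zero] at hc
    have hd : HasDerivAt (fun t : ℝ => Complex.normSq (t • site n h)) 0 0 := by
      simpa using hasDerivAt_normSq_line 0 (site n h)
    have h3 := ((hasDerivAt_id (0 : ℝ)).smul_const (site n h)).mul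
      ((Complex.ofRealCLM.hasFDerivAt.comp_hasDerivAt (0 : ℝ) hd).const_sub 1)
    have h4 := hc.unique h3
    simpa using h4.symm
  have hflux : ∀ n : ℤ, 1 ≤ n → n ≤ M →
      (site n h * conj (site (n - 1) p) + site n p * conj (site (n - 1) h)).im = 0 := by
    intro n h1 h2
    have hd : HasDerivAt (fun t : ℝ => tailGain N γ (fun k => site k p + t • site k h) n)
        (∑ k ∈ Finset.Icc n (N : ℤ), γ k * (2 * (site k h * conj (site k p)).re)) 0 :=
      HasDerivAt.fun_sum fun k _ => (hasDerivAt_normSq_line _ _).const_mul _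
    -- The gain has zero variation: up to `M` by `hrad`, and beyond `M` because `p` vanishes there.
    rw [Finset.sum_eq_zero] at hd
    · have := (hlarge n h1 h2).2.unique
        ((hasDerivAt_im_mul_conj_line (site n p) (site n h) (site (n - 1) p)
          (site (n - 1) h)).sub hd)
      rw [sub_zero] at this
      exact this.symm
    · intro k hk
      rw [Finset.mem_Icc] at hk
      rcases le_or_gt k M with hkM | hkM
      · rw [hrad k (by omega) hkM]
        simp
      · rw [hp.small k hkM]
        simp
  have hzero : ∀ n : ℤ, 1 ≤ n → n ≤ M → site n h = 0 := by
    intro n h1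
    refine Int.leInduction (m := 1) (motive := fun n _ => n ≤ M → site n h = 0)
      (fun h2 => ?_) (fun n hn ih h2 => ?_) n h1
    -- Since `site 0` is the conjugate of `site 1`, the first bond is a square and the two terms of
    -- its variation coincide. This fixes the phase itself, not just a phase difference.
    · refine eq_zero_of_re_of_im (hp.large 1 le_rfl h2) (hrad 1 le_rfl h2) (q := site 0 p) ?_
        (by simpa using hp.re_bond_ne_zero hγ le_rfl h2)
      have := hflux 1 le_rfl h2
      simp only [sub_self, site_zero, Complex.conj_conj, mul_comm (site 1 p)] at this ⊢
      rw [Complex.add_im] at this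
      linarith
    · refine eq_zero_of_re_of_im (hp.large (n + 1) (by omega) h2) (hrad (n + 1) (by omega) h2)
        (q := site n p) ?_ (by simpa using hp.re_bond_ne_zero hγ (n := n + 1) (by omega) h2)
      have := hflux (n + 1) (by omega) h2
      simpa [ih (by omega)] using this
  refine config_ext fun n h1 h2 => ?_
  rw [map_zero]
  rcases le_or_gt n M with hn | hn
  · exact hzero n h1 hn
  · exact hsm n hn h2 h1

/-! ### Branches of solutions emanating from the limits -/

theorem IsLimit.exists_branch {γ : ℤ → ℝ} {M : ℤ} {p : Config N}
    (hp : IsLimit γ M p) (hM : M ≤ N)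
    (hγ : ∀ n : ℤ, 1 ≤ n → n ≤ M → |∑ k ∈ Finset.Icc n M, γ k| < 1) :
    ∃ φ : ℝ → Config N, ∃ C r : ℝ, 0 < r ∧
      (∀ᶠ ε in 𝓝[>] 0, ContDiffAt ℝ ω φ ε) ∧ (∀ᶠ ε in 𝓝[>] 0, Solves N γ ε (φ ε)) ∧
      (∀ᶠ ε in 𝓝[>] 0, ‖φ ε - p‖ ≤ C * ε) ∧
      ∀ᶠ ε in 𝓝[>] 0, ∀ v ∈ Metric.ball p r, Solves N γ ε v → v = φ ε := by
  obtain ⟨φ, C, h0, hsm, hz, huniq, hC⟩ := exists_implicit_curve (contDiff_reducedMap γ M)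
    ((hp.solves hM).reducedMap_eq_zero M) (hp.fderiv_reducedMap_injective hM hγ)
  -- Large sites stay nonzero along the curve, as needed to return from the reduced map to the full
  -- equations. The converse passage, used for uniqueness, needs no such condition.
  have hne : ∀ᶠ ε in 𝓝 (0 : ℝ), ∀ n ∈ Finset.Icc 1 M, site n (φ ε) ≠ 0 := by
    rw [Filter.eventually_all_finset]
    intro n hn
    rw [Finset.mem_Icc] at hn
    have hcont : ContinuousAt (fun ε => site n (φ ε)) 0 :=
      (site n).continuous.continuousAt.comp hsm.self_of_nhds.continuousAt
    refine hcont.eventually_ne ?_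
    rw [h0]
    intro h
    have := hp.large n hn.1 hn.2
    simp [h] at this
  rw [nhds_prod_eq, Filter.eventually_prod_iff] at huniq
  obtain ⟨pa, ha, pb, hb, hab⟩ := huniq
  obtain ⟨r, hr, hball⟩ := Metric.eventually_nhds_iff_ball.1 hb
  refine ⟨φ, C, r, hr, hsm.filter_mono nhdsWithin_le_nhds, ?_, ?_, ?_⟩
  · filter_upwards [hz.filter_mono nhdsWithin_le_nhds, hne.filter_mono nhdsWithin_le_nhds,
      self_mem_nhdsWithin] with ε h1 h2 h3
    exact solves_of_reducedMap_eq_zero (Set.mem_Ioi.1 h3).ne' hM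
      (fun n hn1 hn2 => h2 n (Finset.mem_Icc.2 ⟨hn1, hn2⟩)) h1
  · filter_upwards [hC.filter_mono nhdsWithin_le_nhds, self_mem_nhdsWithin] with ε h1 h2
    rwa [abs_of_pos h2] at h1
  · filter_upwards [ha.filter_mono nhdsWithin_le_nhds] with ε h1 v hv hs
    exact (hab h1 (hball v hv) (hs.reducedMap_eq_zero M)).symm

/-! ### All solutions for small `ε` are close to limits -/

/-- At a site of maximal modulus the right side is at most `3 ‖v‖`, so `|1 - ‖v‖²| ≤ 3` if `v ≠ 0`.
The reflected neighbour at site `0` also has modulus at most `‖v‖`. -/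
theorem Solves.norm_le_two {γ : ℤ → ℝ} (hγ : ∀ n : ℤ, 1 ≤ n → n ≤ N → |γ n| ≤ 1) {ε : ℝ}
    (hε : |ε| ≤ 1) {v : Config N} (h : Solves N γ ε v) : ‖v‖ ≤ 2 := by
  rcases isEmpty_or_nonempty (Finset.Icc (1 : ℤ) N) with he | he
  · rw [Subsingleton.elim v 0, norm_zero]
    norm_num
  obtain ⟨i, hi⟩ := Finite.exists_max fun i => ‖v i‖
  have hv : ‖v‖ = ‖v i‖ := le_antisymm
    ((pi_norm_le_iff_of_nonneg (norm_nonneg _)).2 hi) (norm_le_pi_norm v i)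
  have hi' := Finset.mem_Icc.1 i.2
  have hb := congrArg norm (h i hi'.1 hi'.2).1
  have hs : ‖site (i : ℤ) v‖ = ‖v‖ := by rw [site_coe, hv]
  have h1 : ‖(1 : ℂ) - (Complex.normSq (site (i : ℤ) v) : ℂ)‖ = |1 - ‖v‖ ^ 2| := by
    rw [Complex.normSq_eq_norm_sq, hs, ← Complex.ofReal_one, ← Complex.ofReal_sub,
      Complex.norm_real, Real.norm_eq_abs]
  have h2 : ‖site ((i : ℤ) + 1) v + site ((i : ℤ) - 1) v
      + Complex.I * (γ i : ℂ) * site (i : ℤ) v‖ ≤ 3 * ‖v‖ := by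
    have h3 : ‖Complex.I * (γ i : ℂ) * site (i : ℤ) v‖ ≤ ‖v‖ := by
      rw [norm_mul, norm_mul, Complex.norm_I, one_mul, Complex.norm_real, Real.norm_eq_abs, hs]
      exact mul_le_of_le_one_left (norm_nonneg _) (hγ i hi'.1 hi'.2)
    have h4 := norm_add₃_le (a := site ((i : ℤ) + 1) v) (b := site ((i : ℤ) - 1) v)
      (c := Complex.I * (γ i : ℂ) * site (i : ℤ) v)
    have h5 := norm_site_le v (i + 1)
    have h6 := norm_site_le v (i - 1)
    linarith
  rw [norm_mul, norm_mul, h1, hs, Complex.norm_real, Real.norm_eq_abs] at hb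
  have h7 : ‖v‖ * |1 - ‖v‖ ^ 2| ≤ 3 * ‖v‖ := by
    rw [hb]
    exact (mul_le_of_le_one_left (norm_nonneg _) hε).trans h2
  by_contra hlt
  have h8 : |1 - ‖v‖ ^ 2| ≤ 3 := by
    refine le_of_mul_le_mul_left ?_ (show 0 < ‖v‖ by linarith)
    linarith
  have := (abs_le.1 h8).1
  nlinarith

theorem isClosed_solves (γ : ℤ → ℝ) :
    IsClosed {x : ℝ × Config N | Solves N γ x.1 x.2} := by
  have hs : ∀ n : ℤ, Continuous (fun x : ℝ × Config N => site n x.2) := fun n =>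
    (site n).continuous.comp continuous_snd
  have hN : ∀ n : ℤ, Continuous (fun x : ℝ × Config N => Complex.normSq (site n x.2)) := fun n =>
    Complex.continuous_normSq.comp (hs n)
  simp only [Solves, Set.ofPred_forall]
  refine isClosed_iInter fun n => isClosed_iInter fun _ => isClosed_iInter fun _ => ?_
  refine IsClosed.inter (isClosed_eq ?_ ?_) (isClosed_eq ?_ ?_)
  · exact (hs _).mul (continuous_const.sub (Complex.continuous_ofReal.comp (hN _)))
  · exact (Complex.continuous_ofReal.comp continuous_fst).mul
      (((hs _).add (hs _)).add (continuous_const.mul (hs _)))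
  · exact Complex.continuous_im.comp ((hs _).mul (Complex.continuous_conj.comp (hs _)))
  · exact continuous_finsetSum _ fun k _ => continuous_const.mul (hN k)

/-- Solutions stay in a fixed compact ball and `Solves` is a closed condition in `(ε, v)`; hence
solutions outside `U` cannot persist as `ε → 0`. -/
theorem eventually_solves_mem {γ : ℤ → ℝ} (hγ : ∀ n : ℤ, 1 ≤ n → n ≤ N → |γ n| ≤ 1)
    {U : Set (Config N)} (hU : IsOpen U) (h : ∀ p, Solves N γ 0 p → p ∈ U) :
    ∀ᶠ ε in 𝓝[>] 0, ∀ v, Solves N γ ε v → v ∈ U := by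
  have hK : ∀ᶠ ε in 𝓝 (0 : ℝ), ∀ v ∈ Metric.closedBall (0 : Config N) 2,
      Solves N γ ε v → v ∈ U := by
    refine (isCompact_closedBall _ _).eventually_forall_of_forall_eventually fun v _ => ?_
    by_cases hv : Solves N γ 0 v
    · filter_upwards [(hU.preimage continuous_snd).mem_nhds (h v hv)] with z hz _ using hz
    · filter_upwards [(isClosed_solves γ).isOpen_compl.mem_nhds hv] with z hz hz'
      exact absurd hz' hz
  filter_upwards [hK.filter_mono nhdsWithin_le_nhds, Ioo_mem_nhdsGT (zero_lt_one' ℝ)]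
    with ε h1 h2 v hv
  refine h1 v ?_ hv
  rw [mem_closedBall_zero_iff]
  exact hv.norm_le_two hγ (by rw [abs_of_pos h2.1]; exact h2.2.le)

/-! ### Enumeration of the limits -/

/-- The two numbers of modulus one with imaginary part `s`. -/
noncomputable def phasor (b : Bool) (s : ℝ) : ℂ := ⟨if b then √(1 - s ^ 2) else -√(1 - s ^ 2), s⟩

theorem normSq_phasor (b : Bool) {s : ℝ} (hs : |s| < 1) : Complex.normSq (phasor b s) = 1 := by
  have h1 : 0 ≤ 1 - s ^ 2 := by
    have := (sq_lt_one_iff_abs_lt_one s).2 hs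
    linarith
  have h2 := Real.mul_self_sqrt h1
  cases b <;> simp only [phasor, Complex.normSq_apply, if_true, Bool.false_eq_true, if_false] <;>
    linarith

theorem phasor_injective {s : ℝ} (hs : |s| < 1) {b b' : Bool} (h : phasor b s = phasor b' s) :
    b = b' := by
  have h1 : 0 < √(1 - s ^ 2) := Real.sqrt_pos.2 (by
    have := (sq_lt_one_iff_abs_lt_one s).2 hs
    linarith)
  have h2 := congrArg Complex.re h
  cases b <;> cases b' <;> simp [phasor] at h2 ⊢ <;> linarith

theorem exists_eq_phasor {z : ℂ} (hz : Complex.normSq z = 1) : ∃ b, z = phasor b z.im := by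
  rw [Complex.normSq_apply] at hz
  have h : 1 - z.im ^ 2 = z.re ^ 2 := by linarith
  rcases le_total 0 z.re with hr | hr
  · exact ⟨true, by apply Complex.ext <;> simp [phasor, h, Real.sqrt_sq_eq_abs, abs_of_nonneg hr]⟩
  · exact ⟨false, by apply Complex.ext <;> simp [phasor, h, Real.sqrt_sq_eq_abs, abs_of_nonpos hr]⟩

/-- A sequence with `z 0 ^ 2 = B 0` and `z (k + 1) / z k = B (k + 1)`. -/
noncomputable def phaseWalk (B : ℕ → ℂ) : ℕ → ℂ
  | 0 => B 0 ^ (((2 : ℕ) : ℂ)⁻¹)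
  | k + 1 => phaseWalk B k * B (k + 1)

theorem phaseWalk_zero_sq (B : ℕ → ℂ) : phaseWalk B 0 ^ 2 = B 0 :=
  Complex.cpow_nat_inv_pow _ two_ne_zero

theorem normSq_phaseWalk {B : ℕ → ℂ} {M : ℕ} (hB : ∀ k < M, Complex.normSq (B k) = 1) :
    ∀ k < M, Complex.normSq (phaseWalk B k) = 1 := by
  intro k
  induction k with
  | zero =>
    intro h
    have := hB 0 h
    rw [← phaseWalk_zero_sq B, map_pow] at this
    exact (pow_eq_one_iff_of_nonneg (Complex.normSq_nonneg _) two_ne_zero).1 this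
  | succ k ih =>
    intro h
    rw [phaseWalk, map_mul, ih (by omega), hB _ h, one_mul]

/-- The limit with large sites `1, ..., M` whose bond phases are selected by the binary digits
of `j`. -/
noncomputable def limitPoint (N : ℕ) (γ : ℤ → ℝ) (M j : ℕ) : Config N := fun i =>
  if (i : ℤ) ≤ M then
    phaseWalk (fun k => phasor (j.testBit k) (∑ n ∈ Finset.Icc ((k : ℤ) + 1) M, γ n))
      ((i : ℤ) - 1).toNat
  else 0

theorem site_limitPoint {γ : ℤ → ℝ} {M j k : ℕ} (hM : M ≤ N) (hk : k < M) :
    site ((k : ℤ) + 1) (limitPoint N γ M j)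
      = phaseWalk (fun k => phasor (j.testBit k) (∑ n ∈ Finset.Icc ((k : ℤ) + 1) M, γ n)) k := by
  rw [site_of_mem _ (Finset.mem_Icc.2 ⟨by omega, by omega⟩), limitPoint, if_pos]
  · simp
  · simp only
    omega

theorem exists_eq_natCast_add_one {M : ℕ} {n : ℤ} (h1 : 1 ≤ n) (h2 : n ≤ M) :
    ∃ k : ℕ, k < M ∧ n = (k : ℤ) + 1 := ⟨(n - 1).toNat, by omega, by omega⟩

theorem normSq_site_limitPoint {γ : ℤ → ℝ} {M : ℕ} (hM : M ≤ N)
    (hγ : ∀ n : ℤ, 1 ≤ n → n ≤ M → |∑ k ∈ Finset.Icc n (M : ℤ), γ k| < 1)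
    (j : ℕ) {k : ℕ} (hk : k < M) :
    Complex.normSq (site ((k : ℤ) + 1) (limitPoint N γ M j)) = 1 := by
  rw [site_limitPoint hM hk]
  exact normSq_phaseWalk (fun k hk => normSq_phasor _ (hγ _ (by omega) (by omega))) k hk

theorem bond_limitPoint {γ : ℤ → ℝ} {M : ℕ} (hM : M ≤ N)
    (hγ : ∀ n : ℤ, 1 ≤ n → n ≤ M → |∑ k ∈ Finset.Icc n (M : ℤ), γ k| < 1)
    (j : ℕ) {k : ℕ} (hk : k < M) :
    site ((k : ℤ) + 1) (limitPoint N γ M j) * conj (site (k : ℤ) (limitPoint N γ M j))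
      = phasor (j.testBit k) (∑ n ∈ Finset.Icc ((k : ℤ) + 1) M, γ n) := by
  cases k with
  | zero =>
    have h := site_limitPoint (γ := γ) (j := j) hM hk
    rw [Nat.cast_zero, zero_add] at h
    rw [Nat.cast_zero, zero_add, site_zero, Complex.conj_conj, h, ← pow_two, phaseWalk_zero_sq]
    simp
  | succ k =>
    have h1 := normSq_site_limitPoint hM hγ j (k := k) (by omega)
    rw [site_limitPoint hM hk, phaseWalk, Nat.cast_succ, ← site_limitPoint hM (by omega),
      mul_right_comm, Complex.mul_conj, h1, Complex.ofReal_one, one_mul]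

theorem isLimit_limitPoint {γ : ℤ → ℝ} {M : ℕ} (hM : M ≤ N)
    (hγ : ∀ n : ℤ, 1 ≤ n → n ≤ M → |∑ k ∈ Finset.Icc n (M : ℤ), γ k| < 1)
    (j : ℕ) : IsLimit γ M (limitPoint N γ M j) := by
  refine ⟨fun n h1 h2 => ?_, fun n hn => ?_, fun n h1 h2 => ?_⟩
  · obtain ⟨k, hk, rfl⟩ := exists_eq_natCast_add_one h1 h2
    exact normSq_site_limitPoint hM hγ j hk
  · rcases le_or_gt n N with hnN | hnN
    · rw [site_of_mem _ (Finset.mem_Icc.2 ⟨by omega, hnN⟩), limitPoint, if_neg (not_le.2 hn)]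
    · exact site_eq_zero _ (Or.inr hnN)
  · obtain ⟨k, hk, rfl⟩ := exists_eq_natCast_add_one h1 h2
    rw [flux, add_sub_cancel_right, bond_limitPoint hM hγ j hk]
    rfl

/-- Bonds do not see the sign, and their real parts reveal the binary digits of the index below `M`;
the other digits vanish since the index is less than `2 ^ M`. -/
theorem limitPoint_injective {γ : ℤ → ℝ} {M : ℕ} (hM : M ≤ N)
    (hγ : ∀ n : ℤ, 1 ≤ n → n ≤ M → |∑ k ∈ Finset.Icc n (M : ℤ), γ k| < 1)
    {j j' : ℕ} (hj : j < 2 ^ M) (hj' : j' < 2 ^ M)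
    (h : limitPoint N γ M j = limitPoint N γ M j' ∨ limitPoint N γ M j = -limitPoint N γ M j') :
    j = j' := by
  refine Nat.eq_of_testBit_eq fun k => ?_
  rcases lt_or_ge k M with hk | hk
  · refine phasor_injective (hγ ((k : ℤ) + 1) (by omega) (by omega)) ?_
    rw [← bond_limitPoint hM hγ j hk, ← bond_limitPoint hM hγ j' hk]
    rcases h with h | h <;> simp [h]
  · have h2 : 2 ^ M ≤ 2 ^ k := Nat.pow_le_pow_right two_pos hk
    rw [Nat.testBit_lt_two_pow (hj.trans_le h2), Nat.testBit_lt_two_pow (hj'.trans_le h2)]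

theorem IsLimit.neg {γ : ℤ → ℝ} {M : ℤ} {p : Config N} (h : IsLimit γ M p) :
    IsLimit γ M (-p) := by
  refine ⟨fun n h1 h2 => ?_, fun n hn => ?_, fun n h1 h2 => ?_⟩
  · rw [map_neg, Complex.normSq_neg, h.large n h1 h2]
  · rw [map_neg, h.small n hn, neg_zero]
  · rw [← h.flux_eq n h1 h2]
    simp [flux]

theorem IsLimit.eq_zero {γ : ℤ → ℝ} {p : Config N} (h : IsLimit γ 0 p) : p = 0 :=
  config_ext fun n h1 _ => by rw [h.small n (by omega), map_zero]

theorem IsLimit.ne_zero {γ : ℤ → ℝ} {M : ℤ} (hM : 1 ≤ M) {p : Config N} (h : IsLimit γ M p) :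
    p ≠ 0 := by
  rintro rfl
  simpa using h.large 1 le_rfl hM

theorem IsLimit.le_of_isLimit {γ : ℤ → ℝ} {M M' : ℕ} {p : Config N} (h : IsLimit γ M p)
    (h' : IsLimit γ M' p) : M ≤ M' := by
  by_contra hlt
  have h1 := h.large M (by omega) le_rfl
  rw [h'.small M (by omega)] at h1
  simp at h1

/-- A limit is determined up to sign by its bonds. -/
theorem IsLimit.eq_or_eq_neg_of_bond_eq {γ : ℤ → ℝ} {M : ℤ} {p q : Config N}
    (hp : IsLimit γ M p) (hq : IsLimit γ M q)
    (h : ∀ n : ℤ, 1 ≤ n → n ≤ M →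
      site n p * conj (site (n - 1) p) = site n q * conj (site (n - 1) q)) :
    p = q ∨ p = -q := by
  have key : ∀ q : Config N, IsLimit γ M q → (∀ n : ℤ, 1 ≤ n → n ≤ M →
      site n p * conj (site (n - 1) p) = site n q * conj (site (n - 1) q)) →
      (1 ≤ M → site 1 p = site 1 q) → p = q := by
    intro q hq h h1
    have hM : ∀ n : ℤ, 1 ≤ n → n ≤ M → site n p = site n q := by
      intro n hn
      refine Int.leInduction (m := 1) (motive := fun n _ => n ≤ M → site n p = site n q) h1
        (fun n hn ih h2 => ?_) n hn
      have hb := h (n + 1) (by omega) h2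
      rw [add_sub_cancel_right, ih (by omega)] at hb
      refine mul_right_cancel₀ ?_ hb
      have := hq.large n hn (by omega)
      intro h0
      rw [← Complex.normSq_conj, h0] at this
      simp at this
    refine config_ext fun n hn1 _ => ?_
    rcases le_or_gt n M with hn | hn
    · exact hM n hn1 hn
    · rw [hp.small n hn, hq.small n hn]
  by_cases h1 : 1 ≤ M
  · have hb := h 1 le_rfl h1
    rw [sub_self, site_zero, site_zero, Complex.conj_conj, Complex.conj_conj] at hb
    rcases mul_self_eq_mul_self_iff.1 hb with h2 | h2
    · exact Or.inl (key q hq h fun _ => h2)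
    · refine Or.inr (key (-q) hq.neg (fun n h3 h4 => ?_) fun _ => by rw [map_neg, h2])
      rw [h n h3 h4]
      simp
  · exact Or.inl (key q hq h fun h2 => absurd h2 h1)

theorem IsLimit.exists_limitPoint {γ : ℤ → ℝ} {M : ℕ} (hM : M ≤ N)
    (hγ : ∀ n : ℤ, 1 ≤ n → n ≤ M → |∑ k ∈ Finset.Icc n (M : ℤ), γ k| < 1) {p : Config N}
    (hp : IsLimit γ M p) :
    ∃ j < 2 ^ M, p = limitPoint N γ M j ∨ p = -limitPoint N γ M j := by
  have hb : ∀ k : Fin M, ∃ b, site ((k : ℕ) + 1 : ℤ) p * conj (site ((k : ℕ) : ℤ) p)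
      = phasor b (∑ n ∈ Finset.Icc (((k : ℕ) : ℤ) + 1) M, γ n) := by
    intro k
    have h1 := hp.normSq_bond (n := (k : ℕ) + 1) (by omega) (by omega)
    rw [add_sub_cancel_right] at h1
    obtain ⟨b, hb⟩ := exists_eq_phasor h1
    have h2 := hp.flux_eq ((k : ℕ) + 1) (by omega) (by omega)
    rw [flux, add_sub_cancel_right] at h2
    rw [h2] at hb
    exact ⟨b, hb⟩
  choose b hb using hb
  refine ⟨Nat.ofBits b, Nat.ofBits_lt_two_pow b, ?_⟩
  refine hp.eq_or_eq_neg_of_bond_eq (isLimit_limitPoint hM hγ _) fun n h1 h2 => ?_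
  obtain ⟨k, hk, rfl⟩ := exists_eq_natCast_add_one h1 h2
  rw [add_sub_cancel_right, bond_limitPoint hM hγ _ hk, Nat.testBit_ofBits_lt b k hk, ← hb ⟨k, hk⟩]

theorem finite_solves_zero {γ : ℤ → ℝ}
    (hγ : ∀ M K : ℤ, 1 ≤ K → K ≤ M → M ≤ (N : ℤ) → |∑ n ∈ Finset.Icc K M, γ n| < 1)
    (hγ' : ∀ M K : ℤ, 2 ≤ K → K ≤ M → M ≤ (N : ℤ) → ∑ n ∈ Finset.Icc K M, γ n ≠ 0) :
    {p : Config N | Solves N γ 0 p}.Finite := by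
  refine Set.Finite.subset (s := ⋃ M ∈ Finset.range (N + 1), ⋃ j ∈ Finset.range (2 ^ M),
    {limitPoint N γ M j, -limitPoint N γ M j}) ?_ ?_
  · exact Set.Finite.biUnion (Finset.finite_toSet _) fun M _ =>
      Set.Finite.biUnion (Finset.finite_toSet _) fun j _ => Set.toFinite _
  · intro p hp
    obtain ⟨M, hM, hl⟩ := Solves.exists_isLimit hγ' hp
    obtain ⟨j, hj, h⟩ := hl.exists_limitPoint hM
      fun n h1 h2 => hγ M n h1 h2 (by omega)
    simp only [Set.mem_iUnion, Finset.mem_range]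
    exact ⟨M, by omega, j, hj, h⟩

/-! ### The global solution branches -/

/-- For small `ε > 0` the solutions are the values of finitely many smooth branches, one for each
solution at `ε = 0`. -/
theorem exists_branches {γ : ℤ → ℝ}
    (hγ : ∀ M K : ℤ, 1 ≤ K → K ≤ M → M ≤ (N : ℤ) → |∑ n ∈ Finset.Icc K M, γ n| < 1)
    (hγ' : ∀ M K : ℤ, 2 ≤ K → K ≤ M → M ≤ (N : ℤ) → ∑ n ∈ Finset.Icc K M, γ n ≠ 0) :
    ∃ φ : Config N → ℝ → Config N, ∃ δ C : ℝ, 0 < δ ∧ ∀ ε ∈ Set.Ioo 0 δ,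
      (∀ p, Solves N γ 0 p → ContDiffAt ℝ ω (φ p) ε ∧ Solves N γ ε (φ p ε) ∧
        ‖φ p ε - p‖ ≤ C * ε ∧ φ (-p) ε = -φ p ε ∧
        ∀ q, Solves N γ 0 q → φ p ε = φ q ε → p = q) ∧
      ∀ v, Solves N γ ε v → ∃ p, Solves N γ 0 p ∧ v = φ p ε := by
  have hfin := finite_solves_zero hγ hγ'
  have hex : ∀ p : Config N, Solves N γ 0 p → ∃ φ : ℝ → Config N, ∃ C r : ℝ, 0 < r ∧
      (∀ᶠ ε in 𝓝[>] 0, ContDiffAt ℝ ω φ ε) ∧ (∀ᶠ ε in 𝓝[>] 0, Solves N γ ε (φ ε)) ∧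
      (∀ᶠ ε in 𝓝[>] 0, ‖φ ε - p‖ ≤ C * ε) ∧
      ∀ᶠ ε in 𝓝[>] 0, ∀ v ∈ Metric.ball p r, Solves N γ ε v → v = φ ε := by
    intro p hp
    obtain ⟨M, hM, hl⟩ := hp.exists_isLimit hγ'
    exact hl.exists_branch (by omega) fun n h1 h2 => hγ M n h1 h2 (by omega)
  choose! φ C r hr hsm hsol hbd huniq using hex
  -- Finiteness of the set of limits gives one constant for all branches, and below a common range
  -- of `ε`.
  obtain ⟨C', hC'⟩ := (hfin.image C).bddAbove
  have hlim : ∀ p, Solves N γ 0 p → Tendsto (φ p) (𝓝[>] 0) (𝓝 p) := by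
    intro p hp
    rw [tendsto_iff_norm_sub_tendsto_zero]
    refine squeeze_zero' (Eventually.of_forall fun _ => norm_nonneg _) (hbd p hp) ?_
    have : Tendsto (fun ε : ℝ => C p * ε) (𝓝 0) (𝓝 (C p * 0)) :=
      (continuous_const.mul continuous_id).tendsto 0
    rw [mul_zero] at this
    exact this.mono_left nhdsWithin_le_nhds
  have hneg : ∀ {ε : ℝ} {p : Config N}, ε ≠ 0 → Solves N γ ε p → Solves N γ ε (-p) := by
    intro ε p hε hp
    rw [solves_iff_balancedAt hε] at hp ⊢
    intro n h1 h2
    have := hp n h1 h2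
    simp only [BalancedAt, map_neg, Complex.normSq_neg] at this ⊢
    linear_combination -this
  have hneg0 : ∀ p : Config N, Solves N γ 0 p → Solves N γ 0 (-p) := by
    intro p hp
    obtain ⟨M, hM, hl⟩ := hp.exists_isLimit hγ'
    exact hl.neg.solves (by omega)
  -- For small `ε > 0`, `-φ p ε` is a solution close to `-p`, so local uniqueness identifies it with
  -- the branch from `-p`.
  have hsymm : ∀ p, Solves N γ 0 p → ∀ᶠ ε in 𝓝[>] 0, φ (-p) ε = -φ p ε := by
    intro p hp
    filter_upwards [huniq _ (hneg0 p hp), hsol p hp, self_mem_nhdsWithin,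
      (hlim p hp).neg.eventually (Metric.ball_mem_nhds (-p) (hr _ (hneg0 p hp)))]
      with ε h1 h2 h3 h4
    exact (h1 _ h4 (hneg (Set.mem_Ioi.1 h3).ne' h2)).symm
  have hsep : ∀ p, Solves N γ 0 p → ∀ᶠ ε in 𝓝[>] 0,
      ∀ q ∈ {q : Config N | Solves N γ 0 q}, φ p ε = φ q ε → p = q := by
    intro p hp
    rw [hfin.eventually_all]
    intro q hq
    by_cases hpq : p = q
    · exact Eventually.of_forall fun _ _ => hpq
    · have h1 := ((hlim p hp).sub (hlim q hq)).eventually_ne (sub_ne_zero.2 hpq)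
      filter_upwards [h1] with ε h1 h2
      exact absurd (sub_eq_zero.2 h2) h1
  have hloc : ∀ᶠ ε in 𝓝[>] 0, ∀ p ∈ {p : Config N | Solves N γ 0 p},
      ContDiffAt ℝ ω (φ p) ε ∧ Solves N γ ε (φ p ε) ∧ ‖φ p ε - p‖ ≤ C' * ε ∧
        φ (-p) ε = -φ p ε ∧ (∀ q ∈ {q : Config N | Solves N γ 0 q}, φ p ε = φ q ε → p = q) ∧
        ∀ v ∈ Metric.ball p (r p), Solves N γ ε v → v = φ p ε := by
    rw [hfin.eventually_all]
    intro p hp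
    filter_upwards [hsm p hp, hsol p hp, hbd p hp, hsymm p hp, hsep p hp, huniq p hp,
      self_mem_nhdsWithin] with ε h1 h2 h3 h4 h5 h6 h7
    refine ⟨h1, h2, h3.trans ?_, h4, h5, h6⟩
    exact mul_le_mul_of_nonneg_right (hC' ⟨p, hp, rfl⟩) (le_of_lt h7)
  have hnear := eventually_solves_mem (N := N) (γ := γ)
    -- The bound on a single `γ n` is the hypothesis for a one-site interval.
    (fun n h1 h2 => by simpa using (hγ n n h1 le_rfl h2).le)
    (U := ⋃ p ∈ {p : Config N | Solves N γ 0 p}, Metric.ball p (r p))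
    (isOpen_biUnion fun p _ => Metric.isOpen_ball)
    (fun p hp => Set.mem_biUnion (show p ∈ {p : Config N | Solves N γ 0 p} from hp)
      (Metric.mem_ball_self (hr p hp)))
  obtain ⟨δ, hδ, hsub⟩ := mem_nhdsGT_iff_exists_Ioo_subset.1 (hloc.and hnear)
  refine ⟨φ, δ, C', hδ, fun ε hε => ?_⟩
  obtain ⟨h1, h2⟩ := hsub hε
  refine ⟨fun p hp => ?_, fun v hv => ?_⟩
  · obtain ⟨a, b, c, d, e, _⟩ := h1 p hp
    exact ⟨a, b, c, d, e⟩
  · obtain ⟨p, hp, hvp⟩ := Set.mem_iUnion₂.1 (h2 v hv)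
    exact ⟨p, hp, (h1 p hp).2.2.2.2.2 v hvp hv⟩

/-! ### Modes and rescaled solutions -/

/-- The state `w = √E v` of a rescaled configuration. -/
noncomputable def state (E : ℝ) (v : Config N) : ℤ → ℂ := fun n => (√E : ℂ) * site n v

theorem state_neg (E : ℝ) (v : Config N) : state E (-v) = -state E v := by
  funext n
  simp [state]

theorem state_injective {E : ℝ} (hE : 0 < E) : Function.Injective (state (N := N) E) := by
  intro v v' h
  have hs : (√E : ℂ) ≠ 0 := by exact_mod_cast (Real.sqrt_pos.2 hE).ne'
  exact config_ext fun n _ _ => mul_left_cancel₀ hs (congrFun h n)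

theorem norm_state_sq {E : ℝ} (hE : 0 < E) (v : Config N) (n : ℤ) :
    ‖state E v n‖ ^ 2 = E * Complex.normSq (site n v) := by
  rw [state, norm_mul, mul_pow, Complex.norm_real, Real.norm_eq_abs, sq_abs, Real.sq_sqrt hE.le,
    Complex.normSq_eq_norm_sq]

theorem stationary_state_iff {γ : ℤ → ℝ} {E : ℝ} (hE : 0 < E) (v : Config N) (n : ℤ) :
    (E : ℂ) * state E v n = state E v (n + 1) + state E v (n - 1)
      + Complex.I * (γ n : ℂ) * state E v n + ((‖state E v n‖ ^ 2 : ℝ) : ℂ) * state E v n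
    ↔ BalancedAt γ E⁻¹ (site · v) n := by
  have hs : (√E : ℂ) ≠ 0 := by exact_mod_cast (Real.sqrt_pos.2 hE).ne'
  have hE' : (E : ℂ) ≠ 0 := by exact_mod_cast hE.ne'
  rw [norm_state_sq hE, BalancedAt]
  simp only [state]
  push_cast
  constructor
  · intro h
    apply mul_left_cancel₀ (mul_ne_zero hE' hs)
    field_simp
    linear_combination (norm := (field_simp; ring)) h / (√E : ℂ)
  · intro h
    linear_combination (norm := (field_simp; ring)) (E : ℂ) * (√E : ℂ) * h

theorem isPTMode_state_iff {γ : ℤ → ℝ} {E : ℝ} (hE : 0 < E) (v : Config N) :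
    IsPTMode N γ E (state E v) ↔ Solves N γ E⁻¹ v := by
  rw [solves_iff_balancedAt (inv_ne_zero hE.ne')]
  refine ⟨fun h n h1 h2 => (stationary_state_iff hE v n).1 (h.stationary n h1 h2), fun h => ?_⟩
  refine ⟨fun n hn => ?_, ?_, fun n h1 h2 => (stationary_state_iff hE v n).2 (h n h1 h2)⟩
  · rw [state, site_eq_zero v hn, mul_zero]
  · funext n
    simp [PT, state, site_reflect]

theorem IsPTMode.exists_state {γ : ℤ → ℝ} {E : ℝ} (hE : 0 < E) {w : ℤ → ℂ}
    (h : IsPTMode N γ E w) : ∃ v : Config N, w = state E v := by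
  have hs : (√E : ℂ) ≠ 0 := by exact_mod_cast (Real.sqrt_pos.2 hE).ne'
  refine ⟨fun i => w i / √E, ?_⟩
  set v : Config N := fun i => w i / √E with hv
  have key : ∀ n ∈ Finset.Icc (1 : ℤ) N, w n = state E v n := by
    intro n hn
    rw [state, site_of_mem v hn, hv]
    field_simp
  funext n
  by_cases h1 : n ∈ Finset.Icc (1 : ℤ) N
  · exact key n h1
  by_cases h2 : 1 - n ∈ Finset.Icc (1 : ℤ) N
  · have h3 := congrFun h.invariant n
    rw [← h3, PT, key _ h2, state, state, site_reflect]
    simp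
  · rw [Finset.mem_Icc] at h1 h2
    have h3 : n < -(N : ℤ) + 1 ∨ (N : ℤ) < n := by omega
    rw [h.support n h3, state, site_eq_zero v h3, mul_zero]

theorem abs_normSq_sub_one_le {a b : ℂ} {d : ℝ} (hb : Complex.normSq b = 1) (h : ‖a - b‖ ≤ d) :
    |Complex.normSq a - 1| ≤ d * (d + 2) := by
  rw [Complex.normSq_eq_norm_sq] at hb ⊢
  have hb' : ‖b‖ = 1 := (pow_eq_one_iff_of_nonneg (norm_nonneg _) two_ne_zero).1 hb
  have h1 : |‖a‖ - 1| ≤ d := by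
    rw [← hb']
    exact (abs_norm_sub_norm_le a b).trans h
  have h2 := abs_le.1 h1
  have h3 : |‖a‖ + 1| ≤ d + 2 := by
    rw [abs_of_nonneg (by positivity)]
    linarith
  rw [show ‖a‖ ^ 2 - 1 = (‖a‖ - 1) * (‖a‖ + 1) by ring, abs_mul]
  exact mul_le_mul h1 h3 (abs_nonneg _) ((abs_nonneg _).trans h1)

/-- A branch that emanates from a limit with large sites `1, ..., M` is a family of modes. -/
theorem IsLimit.isModeFamily {γ : ℤ → ℝ} {M : ℕ} {p : Config N} (hp : IsLimit γ M p)
    {φ : ℝ → Config N} {δ C : ℝ} (hC : 0 ≤ C)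
    (h : ∀ ε ∈ Set.Ioo 0 δ, ContDiffAt ℝ ω φ ε ∧ Solves N γ ε (φ ε) ∧ φ ε ≠ 0 ∧
      ‖φ ε - p‖ ≤ C * ε) {E₀ : ℝ} (h1 : 1 ≤ E₀) (hδ : ∀ E, E₀ < E → E⁻¹ ∈ Set.Ioo 0 δ) :
    IsModeFamily N γ M E₀ (C * (C + 2) + 1) (fun E => state E (φ E⁻¹)) := by
  have hpos : ∀ E, E₀ < E → 0 < E := fun E hE => by linarith
  have hdist : ∀ E, E₀ < E → ∀ n, ‖site n (φ E⁻¹) - site n p‖ ≤ C * E⁻¹ := by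
    intro E hE n
    rw [← map_sub]
    exact (norm_site_le _ n).trans (h _ (hδ E hE)).2.2.2
  refine ⟨fun E hE => ⟨?_, fun h0 => ?_⟩, fun n => ?_, fun E hE n hn1 hn2 => ?_,
    fun E hE n hn1 _ => ?_⟩
  · exact (isPTMode_state_iff (hpos E hE) _).2 (h _ (hδ E hE)).2.1
  · refine (h _ (hδ E hE)).2.2.1 (state_injective (hpos E hE) (h0.trans ?_))
    funext n
    simp [state]
  · intro E hE
    have hE0 : E ≠ 0 := (hpos E hE).ne'
    have hφ : ContDiffAt ℝ ω (fun E => φ E⁻¹) E :=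
      (h _ (hδ E hE)).1.comp E (contDiffAt_inv ℝ hE0)
    have hs : ContDiffAt ℝ ω (fun E : ℝ => (√E : ℂ)) E :=
      Complex.ofRealCLM.contDiff.contDiffAt.comp E (Real.contDiffAt_sqrt hE0)
    exact ((hs.mul ((site n).contDiff.contDiffAt.comp E hφ)).of_le le_top).contDiffWithinAt
  · have hE0 := hpos E hE
    have h3 := abs_normSq_sub_one_le (hp.large n hn1 hn2) (hdist E hE n)
    have h4 : E⁻¹ ≤ 1 := inv_le_one_of_one_le₀ (by linarith)
    have h5 : C * E⁻¹ ≤ C := mul_le_of_le_one_right hC h4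
    rw [norm_state_sq hE0, show E * Complex.normSq (site n (φ E⁻¹)) - E
      = E * (Complex.normSq (site n (φ E⁻¹)) - 1) by ring, abs_mul, abs_of_pos hE0]
    calc E * |Complex.normSq (site n (φ E⁻¹)) - 1|
        ≤ E * (C * E⁻¹ * (C * E⁻¹ + 2)) := mul_le_mul_of_nonneg_left h3 hE0.le
      _ = C * (C * E⁻¹ + 2) := by field_simp
      _ ≤ C * (C + 2) := mul_le_mul_of_nonneg_left (by linarith) hC
      _ ≤ C * (C + 2) + 1 := by linarith
  · have hE0 := hpos E hE
    have h3 := hdist E hE n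
    rw [hp.small n hn1, sub_zero] at h3
    rw [norm_state_sq hE0, Complex.normSq_eq_norm_sq]
    have h4 : 0 ≤ E⁻¹ := (inv_pos.2 hE0).le
    calc E * ‖site n (φ E⁻¹)‖ ^ 2
        ≤ E * (C * E⁻¹) ^ 2 :=
          mul_le_mul_of_nonneg_left (pow_le_pow_left₀ (norm_nonneg _) h3 2) hE0.le
      _ = C ^ 2 * E⁻¹ := by field_simp
      _ ≤ (C * (C + 2) + 1) * E⁻¹ := mul_le_mul_of_nonneg_right (by nlinarith) h4

/-! ### Counting gauge classes -/

theorem gaugeClass_eq_iff {w w' : ℤ → ℂ} : gaugeClass w = gaugeClass w' ↔ w = w' ∨ w = -w' := by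
  constructor
  · intro h
    have : w ∈ gaugeClass w' := h ▸ Set.mem_insert w _
    simpa [gaugeClass] using this
  · rintro (rfl | rfl)
    · rfl
    · rw [gaugeClass, neg_neg, Set.pair_comm, gaugeClass]

theorem sum_Icc_two_pow (N : ℕ) : ∑ M ∈ Finset.Icc 1 N, 2 ^ M = 2 ^ (N + 1) - 2 := by
  induction N with
  | zero => simp
  | succ N ih =>
    rw [Finset.sum_Icc_succ_top (by omega), ih]
    have : 2 ≤ 2 ^ (N + 1) := Nat.le_self_pow (by omega) 2
    rw [pow_succ 2 (N + 1)]
    omega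

/-- Families of modes that exhaust all modes and are distinct up to sign count gauge classes. -/
theorem encard_gaugeClass_modes {γ : ℤ → ℝ} {E : ℝ} (u : (M : ℕ) → Fin (2 ^ M) → ℤ → ℂ)
    (hmem : ∀ M : ℕ, 1 ≤ M → M ≤ N → ∀ j, u M j ∈ modes N γ E)
    (hinj : ∀ p q : (M : ℕ) × Fin (2 ^ M), 1 ≤ p.1 → p.1 ≤ N → 1 ≤ q.1 → q.1 ≤ N →
      gaugeClass (u p.1 p.2) = gaugeClass (u q.1 q.2) → p = q)
    (hex : ∀ w ∈ modes N γ E, ∃ M : ℕ, 1 ≤ M ∧ M ≤ N ∧ ∃ j, w = u M j ∨ w = -u M j) :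
    (gaugeClass '' modes N γ E).encard = ((2 ^ (N + 1) - 2 : ℕ) : ℕ∞) := by
  set I : Finset ((M : ℕ) × Fin (2 ^ M)) := (Finset.Icc 1 N).sigma fun _ => Finset.univ with hI
  have hmemI : ∀ p, p ∈ I ↔ 1 ≤ p.1 ∧ p.1 ≤ N := fun p => by simp [hI]
  have himage : gaugeClass '' modes N γ E =
      (fun p : (M : ℕ) × Fin (2 ^ M) => gaugeClass (u p.1 p.2)) '' I := by
    ext c
    constructor
    · rintro ⟨w, hw, rfl⟩
      obtain ⟨M, h1, h2, j, h⟩ := hex w hw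
      exact ⟨⟨M, j⟩, (hmemI _).2 ⟨h1, h2⟩, (gaugeClass_eq_iff.2 h).symm⟩
    · rintro ⟨p, hp, rfl⟩
      obtain ⟨h1, h2⟩ := (hmemI p).1 hp
      exact ⟨_, hmem p.1 h1 h2 p.2, rfl⟩
  rw [himage, Set.InjOn.encard_image, Set.encard_coe_eq_coe_finsetCard, hI, Finset.card_sigma]
  · simp only [Finset.card_univ, Fintype.card_fin]
    rw [sum_Icc_two_pow]
  · intro p hp q hq h
    obtain ⟨h1, h2⟩ := (hmemI p).1 hp
    obtain ⟨h3, h4⟩ := (hmemI q).1 hq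
    exact hinj p q h1 h2 h3 h4 h

end PTNetwork

/-! ### Assembly of the main theorem -/

theorem mainTheorem1 (N : ℕ) (hN : 1 ≤ N) (γ : ℤ → ℝ)
    (hγ : ∀ M K : ℤ, 1 ≤ K → K ≤ M → M ≤ (N : ℤ) → |∑ n ∈ Finset.Icc K M, γ n| < 1)
    (hγ' : ∀ M K : ℤ, 2 ≤ K → K ≤ M → M ≤ (N : ℤ) → ∑ n ∈ Finset.Icc K M, γ n ≠ 0) :
    ∃ E₀ C : ℝ, 0 < E₀ ∧ 0 < C ∧
      (∀ E : ℝ, E₀ < E →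
        (PTNetwork.gaugeClass '' PTNetwork.modes N γ E).encard = ((2 ^ (N + 1) - 2 : ℕ) : ℕ∞)) ∧
      ∃ u : (M : ℕ) → Fin (2 ^ M) → ℝ → ℤ → ℂ,
        (∀ M : ℕ, 1 ≤ M → M ≤ N → ∀ j : Fin (2 ^ M),
          PTNetwork.IsModeFamily N γ M E₀ C (u M j)) ∧
        (∀ E : ℝ, E₀ < E → ∀ p q : (M : ℕ) × Fin (2 ^ M),
          1 ≤ p.1 → p.1 ≤ N → 1 ≤ q.1 → q.1 ≤ N →
          PTNetwork.gaugeClass (u p.1 p.2 E) = PTNetwork.gaugeClass (u q.1 q.2 E) → p = q) ∧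
        (∀ E : ℝ, E₀ < E → ∀ w ∈ PTNetwork.modes N γ E,
          ∃ M : ℕ, 1 ≤ M ∧ M ≤ N ∧ ∃ j : Fin (2 ^ M), w = u M j E ∨ w = -u M j E) := by
  open PTNetwork in
  obtain ⟨φ, δ, C, hδ, hφ⟩ := exists_branches hγ hγ'
  have hγM : ∀ M : ℕ, M ≤ N → ∀ n : ℤ, 1 ≤ n → n ≤ M →
      |∑ k ∈ Finset.Icc n (M : ℤ), γ k| < 1 := fun M hM n h1 h2 => hγ M n h1 h2 (by omega)
  have hL : ∀ M : ℕ, M ≤ N → ∀ j, IsLimit γ M (limitPoint N γ M j) := fun M hM j =>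
    isLimit_limitPoint hM (hγM M hM) j
  have hS : ∀ M : ℕ, M ≤ N → ∀ j, Solves N γ 0 (limitPoint N γ M j) := fun M hM j =>
    (hL M hM j).solves (by omega)
  have hS0 : Solves N γ 0 (0 : Config N) := by
    intro n _ _
    simp [BalancedAt, flux, tailGain]
  -- Oddness of the branches at `p = -p = 0` shows that the branch from the zero limit is zero.
  have hφ0 : ∀ ε ∈ Set.Ioo 0 δ, φ 0 ε = 0 := by
    intro ε hε
    have := ((hφ ε hε).1 0 hS0).2.2.2.1
    rw [neg_zero] at this
    exact self_eq_neg.1 this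
  have hpos : ∀ E, max 1 δ⁻¹ < E → 0 < E := fun E hE =>
    zero_lt_one.trans ((le_max_left _ _).trans_lt hE)
  have hinv : ∀ E, max 1 δ⁻¹ < E → E⁻¹ ∈ Set.Ioo 0 δ := fun E hE =>
    ⟨inv_pos.2 (hpos E hE), inv_lt_of_inv_lt₀ hδ ((le_max_right _ _).trans_lt hE)⟩
  let u : (M : ℕ) → Fin (2 ^ M) → ℝ → ℤ → ℂ :=
    fun M j E => state E (φ (limitPoint N γ M j) E⁻¹)
  have hfam : ∀ M : ℕ, 1 ≤ M → M ≤ N → ∀ j : Fin (2 ^ M),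
      IsModeFamily N γ M (max 1 δ⁻¹) (|C| * (|C| + 2) + 1) (u M j) := by
    intro M h1 h2 j
    refine (hL M h2 j).isModeFamily (abs_nonneg C) (fun ε hε => ?_) (le_max_left _ _) hinv
    obtain ⟨ha, hb, hc, -, he⟩ := (hφ ε hε).1 _ (hS M h2 j)
    refine ⟨ha, hb, fun h0 => ?_,
      hc.trans (mul_le_mul_of_nonneg_right (le_abs_self C) hε.1.le)⟩
    -- If this branch vanished at `ε` it would meet the zero branch, and separation of branches
    -- would force its limit to be zero.
    exact (hL M h2 j).ne_zero (by omega) (he 0 hS0 (h0.trans (hφ0 ε hε).symm))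
  have hinj : ∀ E : ℝ, max 1 δ⁻¹ < E → ∀ p q : (M : ℕ) × Fin (2 ^ M),
      1 ≤ p.1 → p.1 ≤ N → 1 ≤ q.1 → q.1 ≤ N →
      gaugeClass (u p.1 p.2 E) = gaugeClass (u q.1 q.2 E) → p = q := by
    rintro E hE ⟨M, j⟩ ⟨M', j'⟩ - (h2 : M ≤ N) - (h4 : M' ≤ N) h
    have hp := (hφ _ (hinv E hE)).1 _ (hS M h2 j)
    have hq := (hφ _ (hinv E hE)).1 _ (hS M' h4 j')
    have hpq : limitPoint N γ M j = limitPoint N γ M' j' ∨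
        limitPoint N γ M j = -limitPoint N γ M' j' := by
      rcases gaugeClass_eq_iff.1 h with h | h
      · exact Or.inl (hp.2.2.2.2 _ (hS M' h4 j') (state_injective (hpos E hE) h))
      · refine Or.inr (hp.2.2.2.2 _ ((hL M' h4 j').neg.solves (by omega)) ?_)
        rw [hq.2.2.2.1]
        exact state_injective (hpos E hE) (h.trans (state_neg _ _).symm)
    have hlim : IsLimit γ M' (limitPoint N γ M j) := by
      rcases hpq with h | h
      · exact h ▸ hL M' h4 j'
      · exact h ▸ (hL M' h4 j').neg
    obtain rfl : M = M' :=
      le_antisymm ((hL M h2 j).le_of_isLimit hlim) (hlim.le_of_isLimit (hL M h2 j))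
    exact congrArg _ (Fin.ext (limitPoint_injective h2 (hγM M h2) j.2 j'.2 hpq))
  have hex : ∀ E : ℝ, max 1 δ⁻¹ < E → ∀ w ∈ modes N γ E,
      ∃ M : ℕ, 1 ≤ M ∧ M ≤ N ∧ ∃ j : Fin (2 ^ M), w = u M j E ∨ w = -u M j E := by
    rintro E hE w ⟨hw, hw0⟩
    obtain ⟨v, rfl⟩ := hw.exists_state (hpos E hE)
    obtain ⟨p, hp, rfl⟩ := (hφ _ (hinv E hE)).2 v ((isPTMode_state_iff (hpos E hE) v).1 hw)
    obtain ⟨M, hM, hl⟩ := hp.exists_isLimit hγ'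
    -- The case `M = 0` is the zero branch, which is excluded because the mode is nonzero.
    have hM1 : 1 ≤ M := by
      by_contra h0
      obtain rfl : M = 0 := by omega
      refine hw0 ?_
      rw [IsLimit.eq_zero (show IsLimit γ 0 p by simpa using hl), hφ0 _ (hinv E hE)]
      funext n
      simp [state]
    obtain ⟨j, hj, h⟩ := hl.exists_limitPoint hM (hγM M hM)
    refine ⟨M, hM1, hM, ⟨j, hj⟩, ?_⟩
    rcases h with rfl | rfl
    · exact Or.inl rfl
    · refine Or.inr ?_
      rw [((hφ _ (hinv E hE)).1 _ (hS M hM j)).2.2.2.1, state_neg]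
  refine ⟨max 1 δ⁻¹, |C| * (|C| + 2) + 1, lt_max_of_lt_left one_pos, by positivity,
    fun E hE => ?_, u, hfam, hinj, hex⟩
  exact encard_gaugeClass_modes (fun M j => u M j E)
    (fun M h1 h2 j => (hfam M h1 h2 j).mem_modes E hE) (hinj E hE) (hex E hE)
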